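/- Let $X$ be a compact metric space with its Borel $\sigma$-algebra $\mathfrak B$, and let $r\colon X\to X$ be measurable, onto and finite-to-one, i.e. $0<\#r^{-1}(x)<\infty$ for all $x\in X$. Let $\rho$ be a strongly invariant Borel probability measure for $r$, that is, $$\int_X f\,d\rho=\int_X\frac1{\#r^{-1}(x)}\sum_{r(y)=x}f(y)\,d\rho(x)\qquad\text{for all } f\in L^\infty(X,\rho).$$ Let $m_0\in L^\infty(X,\rho)$ be complex-valued with $$\frac1{\#r^{-1}(x)}\sum_{r(y)=x}|m_0(y)|^2=1\qquad\text{for } \rho\text{-a.e. } x\in X,$$ and let $h\in L^\infty(X,\rho)$ satisfy $h\ge0$ $\rho$-a.e. and $$\frac1{\#r^{-1}(x)}\sum_{r(y)=x}|m_0(y)|^2h(y)=h(x)\qquad\text{for } \rho\text{-a.e. } x\in X.$$ Then $S_0f=m_0\cdot(f\circ r)$ defines a (well-defined, linear) isometry $S_0$ of the complex Hilbert space $L^2(X,h\,d\rho)$ into itself. Suppose in addition that $r$ is averaging with respect to $\rho$, i.e. every set in $\bigcap_{n\ge0}r^{-n}(\mathfrak B)$ has $\rho$-measure $0$ or $1$,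 and that $|m_0|\ne1$ on a set of positive $\rho$-measure. Then $$\bigcap_{k\ge1}S_0^k\bigl(L^2(X,h\,d\rho)\bigr)=\{0\}.$$ -/

import Mathlib

open MeasureTheory
open scoped ENNReal

/-- The average `x ↦ (1 / #r⁻¹(x)) ∑_{r(y) = x} f(y)` of `f` over the fibres of `r`. It is used
only for maps `r` all of whose fibres are finite and non-empty. -/
noncomputable def fiberAverage {X E : Type*} [AddCommGroup E] [Module ℝ E]
    (r : X → X) (f : X → E) (x : X) : E :=
  ((r ⁻¹' {x}).ncard : ℝ)⁻¹ • ∑ᶠ y ∈ r ⁻¹' {x}, f y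

/-- `ρ` is strongly invariant for `r`: for every `f ∈ L^∞(ρ)`,
`∫ f dρ = ∫ (1 / #r⁻¹(x)) ∑_{r(y) = x} f(y) dρ(x)`. -/
def IsStronglyInvariant {X : Type*} [MeasurableSpace X] (r : X → X) (ρ : Measure X) : Prop :=
  ∀ f : X → ℂ, MemLp f ∞ ρ → ∫ x, f x ∂ρ = ∫ x, fiberAverage r f x ∂ρ

/-- The sigma-algebra `⋂ₙ r⁻ⁿ(𝔅)`. -/
abbrev tailSigmaAlgebra {X : Type*} [m : MeasurableSpace X] (r : X → X) : MeasurableSpace X :=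
  ⨅ n : ℕ, MeasurableSpace.comap (r^[n]) m

/-- `r` is averaging with respect to `ρ`: the sigma-algebra `⋂ₙ r⁻ⁿ(𝔅)` contains only sets of
`ρ`-measure `0` or `1`. -/
def IsAveraging {X : Type*} [MeasurableSpace X] (r : X → X) (ρ : Measure X) : Prop :=
  ∀ A : Set X, MeasurableSet[tailSigmaAlgebra r] A → ρ A = 0 ∨ ρ A = 1

/-- The measure `h dρ`. -/
noncomputable def weightedMeasure {X : Type*} [MeasurableSpace X] (ρ : Measure X) (h : X → ℝ) :
    Measure X :=
  ρ.withDensity fun x => ENNReal.ofReal (h x)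

/-! Let E be averaging over the fibres of `r`. Strong invariance says ∫ E g dρ = ∫ g dρ, and E(g ·
u∘r) = E(g) u; so `r` preserves ρ, and E(|m₀|²h) = h makes S₀ isometric.

If f and g lie in every range, both carry the factor m₀ · m₀∘r ⋯ m₀∘r^(k-1), so f/g is a function of
r^k for every k where g ≠ 0, hence constant by averaging. The intersection is thus at most
one-dimensional (`exists_eq_smul_of_mem_range_iterate`), and a non-zero f in it satisfies S₀f = cf
with |c| = 1. With u = |f|² this reads |m₀|² · u∘r = u. Then E(hu) = hu, and averaging forces hu to
be a non-zero constant, so h and u are positive a.e.; now E(u) = E(|m₀|²) u = u makes u constant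
too, whence |m₀| = 1 a.e. (`enorm_sq_ae_eq_one_of_eigenvector`). Both constancy claims come from
`ae_const_of_lintegral_fiberMeasure_le`.

Measurability of E g is not automatic: it rests on images r(B) of Borel sets being analytic, hence
ρ-measurable. -/

section Analytic

-- Universal measurability of analytic sets.

attribute [local instance] PiNat.metricSpaceNatNat in
/-- If every `f '' {x | x i ≤ b i for i < k}` has measure larger than `c`, then the compact image
of `{x | x ≤ b}` has measure at least `c`. -/
theorem le_measure_image_Iic_of_forall_lt {X : Type*} [TopologicalSpace X] [MeasurableSpace X]
    {μ : Measure X} [μ.OuterRegular] {f : (ℕ → ℕ) → X} (hf : Continuous f) {c : ℝ≥0∞}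
    {b : ℕ → ℕ} (hb : ∀ k : ℕ, c < μ (f '' {x | ∀ i < k, x i ≤ b i})) :
    c ≤ μ (f '' Set.Iic b) := by
  by_contra! hlt
  obtain ⟨U, hKU, hUo, hUc⟩ := Set.exists_isOpen_lt_of_lt _ _ hlt
  have hK : IsCompact (Set.Iic b) := by
    have : Set.Iic b = Set.univ.pi fun i => Set.Iic (b i) := by
      ext x; simp [Pi.le_def]
    rw [this]
    exact isCompact_univ_pi fun i => (Set.finite_Iic (b i)).isCompact
  obtain ⟨δ, hδ, hthick⟩ := hK.exists_thickening_subset_open (hUo.preimage hf)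
    (Set.image_subset_iff.1 hKU)
  obtain ⟨k, hk⟩ := exists_pow_lt_of_lt_one hδ (by norm_num : (1 / 2 : ℝ) < 1)
  refine (hb k).not_ge (le_trans (measure_mono ?_) hUc.le)
  rintro _ ⟨x, hx, rfl⟩
  -- Cutting `x` down to `x ⊓ b` lands in the compact box and leaves the first `k` coordinates
  -- alone, so it moves `x` by at most (1/2)^k < δ.
  refine hthick (Metric.mem_thickening_iff.2 ⟨x ⊓ b, Set.mem_Iic.2 inf_le_right, lt_of_le_of_lt ?_ hk⟩)
  refine PiNat.mem_cylinder_iff_dist_le.1 fun i hi => ?_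
  simp [hx i hi]

/-- Inner regularity of analytic sets: an analytic set can be approximated in measure by its compact
subsets. -/
theorem MeasureTheory.AnalyticSet.exists_isCompact_subset_le_measure {X : Type*}
    [TopologicalSpace X] [MeasurableSpace X] {μ : Measure X} [μ.OuterRegular] {s : Set X}
    (hs : AnalyticSet s) {c : ℝ≥0∞} (hc : c < μ s) :
    ∃ K ⊆ s, IsCompact K ∧ c ≤ μ K := by
  rw [AnalyticSet] at hs
  rcases hs with rfl | ⟨f, hf, rfl⟩
  · simp at hc
  let C : ℕ → (ℕ → ℕ) → Set (ℕ → ℕ) := fun k b => {x | ∀ i < k, x i ≤ b i}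
  -- Continuity from below: the bounds on coordinate `k` exhaust the set, so some finite bound keeps
  -- the measure above `c`.
  have step : ∀ (k : ℕ) (b : ℕ → ℕ), c < μ (f '' C k b) →
      ∃ m, c < μ (f '' C (k + 1) (Function.update b k m)) := by
    intro k b h
    have hU : f '' C k b = ⋃ m, f '' C (k + 1) (Function.update b k m) := by
      rw [← Set.image_iUnion]
      congr 1
      ext x
      simp only [C, Set.mem_ofPred_eq, Set.mem_iUnion]
      constructor
      · intro hx
        refine ⟨x k, fun i hi => ?_⟩
        rcases eq_or_ne i k with rfl | hik
        · simp
        · rw [Function.update_of_ne hik]; exact hx i (by omega)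
      · rintro ⟨m, hm⟩ i hi
        have := hm i (by omega)
        rwa [Function.update_of_ne hi.ne] at this
    have hmono : Monotone fun m => f '' C (k + 1) (Function.update b k m) := by
      intro m n hmn
      refine Set.image_mono fun x hx i hi => (hx i hi).trans ?_
      rcases eq_or_ne i k with rfl | hik
      · simpa using hmn
      · simp [Function.update_of_ne hik]
    rw [hU, hmono.measure_iUnion] at h
    exact lt_iSup_iff.1 h
  choose! m hm using step
  let B : ℕ → ℕ → ℕ := fun k => Nat.rec (fun _ => 0) (fun k b => Function.update b k (m k b)) k
  have hB : ∀ k, c < μ (f '' C k (B k)) := by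
    intro k
    induction k with
    | zero => simpa [C] using hc
    | succ k ih => exact hm k (B k) ih
  let b : ℕ → ℕ := fun i => B (i + 1) i
  -- Stage `k` changes coordinate `k` only, so the diagonal `b` agrees with every stage on the
  -- coordinates already fixed.
  have hBb : ∀ k, ∀ i < k, B k i = b i := by
    intro k
    induction k with
    | zero => simp
    | succ k ih =>
      intro i hi
      rcases eq_or_ne i k with rfl | hik
      · rfl
      · rw [← ih i (by omega)]
        exact Function.update_of_ne hik _ _
  refine ⟨f '' Set.Iic b, Set.image_subset_range _ _, ?_, ?_⟩
  · have : Set.Iic b = Set.univ.pi fun i => Set.Iic (b i) := by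
      ext x; simp [Pi.le_def]
    rw [this]
    exact (isCompact_univ_pi fun i => (Set.finite_Iic (b i)).isCompact).image hf
  · refine le_measure_image_Iic_of_forall_lt hf fun k => ?_
    have : {x : ℕ → ℕ | ∀ i < k, x i ≤ b i} = C k (B k) :=
      Set.ext fun x => forall₂_congr fun i hi => by rw [hBb k i hi]
    rw [this]
    exact hB k

/-- Analytic sets are universally measurable. -/
theorem MeasureTheory.AnalyticSet.nullMeasurableSet {X : Type*} [TopologicalSpace X] [T2Space X]
    [MeasurableSpace X] [OpensMeasurableSpace X] {μ : Measure X} [IsFiniteMeasure μ]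
    [μ.OuterRegular] {s : Set X} (hs : AnalyticSet s) : NullMeasurableSet s μ := by
  rcases eq_or_ne (μ s) 0 with h0 | h0
  · exact NullMeasurableSet.of_null h0
  obtain ⟨u, -, hu, hlim⟩ := exists_seq_strictMono_tendsto' (pos_iff_ne_zero.2 h0)
  choose K hKs hK hKu using fun n => hs.exists_isCompact_subset_le_measure (hu n).2
  have hm : MeasurableSet (⋃ n, K n) := .iUnion fun n => (hK n).measurableSet
  have hsub : (⋃ n, K n) ⊆ s := Set.iUnion_subset hKs
  have hle : μ s ≤ μ (⋃ n, K n) :=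
    le_of_tendsto' hlim fun n => (hKu n).trans (measure_mono (Set.subset_iUnion K n))
  have hae : (⋃ n, K n) =ᵐ[μ] toMeasurable μ s :=
    ae_eq_of_subset_of_measure_ge (hsub.trans (subset_toMeasurable μ s))
      (by rwa [measure_toMeasurable]) hm.nullMeasurableSet (measure_ne_top _ _)
  refine hm.nullMeasurableSet.congr (Filter.EventuallyLE.antisymm hsub.eventuallyLE ?_)
  exact (subset_toMeasurable μ s).eventuallyLE.trans hae.symm.le

end Analytic

/-! ### Averages over a single fibre. -/

section Fibre

variable {X : Type*} [MeasurableSpace X] {r : X → X} {ρ : Measure X}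

/-- The uniform probability measure on the fibre of `r` over `x`. -/
noncomputable def fiberMeasure (r : X → X) (x : X) : Measure X :=
  ((r ⁻¹' {x}).ncard : ℝ≥0∞)⁻¹ • Measure.count.restrict (r ⁻¹' {x})

theorem lintegral_fiberMeasure [MeasurableSingletonClass X] (hfin : ∀ x, (r ⁻¹' {x}).Finite)
    (g : X → ℝ≥0∞) (x : X) :
    ∫⁻ y, g y ∂fiberMeasure r x =
      ((r ⁻¹' {x}).ncard : ℝ≥0∞)⁻¹ * ∑ y ∈ (hfin x).toFinset, g y := by
  rw [fiberMeasure, lintegral_smul_measure, smul_eq_mul]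
  congr 1
  conv_lhs => rw [← (hfin x).coe_toFinset]
  rw [lintegral_finset]
  simp

omit [MeasurableSpace X] in
theorem ncard_fiber_ne_zero (hfin : ∀ x, (r ⁻¹' {x}).Finite) (honto : Function.Surjective r)
    (x : X) : (r ⁻¹' {x}).ncard ≠ 0 := by
  obtain ⟨y, hy⟩ := honto x
  exact ((Set.ncard_pos (hfin x)).2 ⟨y, hy⟩).ne'

theorem isProbabilityMeasure_fiberMeasure [MeasurableSingletonClass X]
    (hfin : ∀ x, (r ⁻¹' {x}).Finite) (honto : Function.Surjective r) (x : X) :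
    IsProbabilityMeasure (fiberMeasure r x) := by
  constructor
  rw [← lintegral_one, lintegral_fiberMeasure hfin]
  simp only [Finset.sum_const, nsmul_eq_mul, mul_one]
  rw [← Set.ncard_eq_toFinset_card _ (hfin x)]
  exact ENNReal.inv_mul_cancel (by exact_mod_cast ncard_fiber_ne_zero hfin honto x)
    (ENNReal.natCast_ne_top _)

theorem lintegral_fiberMeasure_congr [MeasurableSingletonClass X]
    (hfin : ∀ x, (r ⁻¹' {x}).Finite) {g g' : X → ℝ≥0∞} {x : X}
    (h : ∀ y, r y = x → g y = g' y) :
    ∫⁻ y, g y ∂fiberMeasure r x = ∫⁻ y, g' y ∂fiberMeasure r x := by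
  rw [lintegral_fiberMeasure hfin, lintegral_fiberMeasure hfin]
  congr 1
  exact Finset.sum_congr rfl fun y hy => h y (by simpa using hy)

/-- `u ∘ r` is constant on each fibre. This is the pull-out rule of conditional expectation. -/
theorem lintegral_fiberMeasure_mul_comp [MeasurableSingletonClass X]
    (hfin : ∀ x, (r ⁻¹' {x}).Finite) (g u : X → ℝ≥0∞) (x : X) :
    ∫⁻ y, g y * u (r y) ∂fiberMeasure r x = (∫⁻ y, g y ∂fiberMeasure r x) * u x := by
  rw [lintegral_fiberMeasure_congr hfin (g' := fun y => g y * u x)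
    fun y hy => by simp only [hy], lintegral_fiberMeasure hfin, lintegral_fiberMeasure hfin,
    mul_assoc, Finset.sum_mul]

omit [MeasurableSpace X] in
theorem fiberAverage_eq_sum {E : Type*} [AddCommGroup E] [Module ℝ E]
    (hfin : ∀ x, (r ⁻¹' {x}).Finite) (g : X → E) (x : X) :
    fiberAverage r g x = ((r ⁻¹' {x}).ncard : ℝ)⁻¹ • ∑ y ∈ (hfin x).toFinset, g y := by
  rw [fiberAverage, finsum_mem_eq_finite_toFinset_sum _ (hfin x)]

theorem ofReal_fiberAverage [MeasurableSingletonClass X] (hfin : ∀ x, (r ⁻¹' {x}).Finite)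
    (honto : Function.Surjective r) {g : X → ℝ} {x : X} (hg : ∀ y, r y = x → 0 ≤ g y) :
    ENNReal.ofReal (fiberAverage r g x) = ∫⁻ y, ENNReal.ofReal (g y) ∂fiberMeasure r x := by
  rw [fiberAverage_eq_sum hfin, lintegral_fiberMeasure hfin, smul_eq_mul,
    ENNReal.ofReal_mul (by positivity), ENNReal.ofReal_inv_of_pos
      (by exact_mod_cast Nat.pos_of_ne_zero (ncard_fiber_ne_zero hfin honto x)),
    ENNReal.ofReal_natCast, ENNReal.ofReal_sum_of_nonneg]
  exact fun y hy => hg y (by simpa using hy)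

open Classical in
/-- The number of points of a finite set is the supremum of the numbers of prefixes of the codes of
its points, for any injective coding by binary sequences. -/
theorem iSup_sum_exists_prefix_eq_card {Y : Type*} {φ : Y → ℕ → Bool} (hφ : Function.Injective φ)
    (S : Finset Y) :
    ⨆ n : ℕ, ∑ w : Fin n → Bool,
      (if ∃ y ∈ S, (fun i : Fin n => φ y i) = w then 1 else 0 : ℝ≥0∞) = S.card := by
  have key : ∀ n : ℕ, ∑ w : Fin n → Bool,
      (if ∃ y ∈ S, (fun i : Fin n => φ y i) = w then 1 else 0 : ℝ≥0∞) =
        (S.image fun y => fun i : Fin n => φ y i).card := by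
    intro n
    rw [Finset.sum_boole]
    congr 2
    ext w
    simp
  simp only [key]
  refine le_antisymm (iSup_le fun n => by exact_mod_cast Finset.card_image_le) ?_
  have hsep : ∀ p : Y × Y, ∃ N, p.1 ≠ p.2 → φ p.1 N ≠ φ p.2 N := by
    rintro ⟨a, b⟩
    by_cases h : a = b
    · exact ⟨0, fun h' => absurd h h'⟩
    · obtain ⟨N, hN⟩ := Function.ne_iff.1 (hφ.ne h)
      exact ⟨N, fun _ => hN⟩
  choose N hN using hsep
  -- One more than every separating index, so prefixes of this length tell all points of `S` apart.
  refine le_iSup_of_le ((S ×ˢ S).sup N + 1) ?_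
  rw [Finset.card_image_of_injOn]
  intro a ha b hb hab
  by_contra hne
  have hlt : N (a, b) < (S ×ˢ S).sup N + 1 :=
    Nat.lt_succ_of_le (Finset.le_sup (Finset.mem_product.2 ⟨ha, hb⟩))
  exact hN (a, b) hne (congrFun hab ⟨_, hlt⟩)

end Fibre

/-! ### Measurability of fibre averages, and strong invariance for non-negative functions. -/

section Transfer

variable {X : Type*} [MetricSpace X] [CompactSpace X] [MeasurableSpace X] [BorelSpace X]
  {r : X → X} {ρ : Measure X}

theorem nullMeasurableSet_image [IsFiniteMeasure ρ] (hr : Measurable r) {B : Set X}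
    (hB : MeasurableSet B) : NullMeasurableSet (r '' B) ρ :=
  (hB.analyticSet_image hr).nullMeasurableSet

/-- Split `B` into Borel cells by binary prefixes of length `n` and count the cells whose image
contains `x`. These counts involve only images of Borel sets, and their supremum over `n` is the
number of points of `B` over `x`. -/
theorem aemeasurable_card_fiber [IsFiniteMeasure ρ] (hr : Measurable r)
    (hfin : ∀ x, (r ⁻¹' {x}).Finite) {B : Set X} (hB : MeasurableSet B) :
    AEMeasurable (fun x => ∑ y ∈ (hfin x).toFinset, B.indicator (1 : X → ℝ≥0∞) y) ρ := by
  classical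
  obtain ⟨φ, hφm, hφ⟩ := MeasurableSpace.measurable_injection_nat_bool_of_countablySeparated X
  have hP : ∀ (n : ℕ) (w : Fin n → Bool),
      MeasurableSet {y | y ∈ B ∧ (fun i : Fin n => φ y i) = w} := by
    intro n w
    refine hB.inter ?_
    have : Measurable fun y => fun i : Fin n => φ y i :=
      measurable_pi_iff.2 fun i => (measurable_pi_apply _).comp hφm
    exact this (measurableSet_singleton w)
  have heq : (fun x => ∑ y ∈ (hfin x).toFinset, B.indicator (1 : X → ℝ≥0∞) y) = fun x =>
      ⨆ n : ℕ, ∑ w : Fin n → Bool,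
        (r '' {y | y ∈ B ∧ (fun i : Fin n => φ y i) = w}).indicator (1 : X → ℝ≥0∞) x := by
    funext x
    have h1 : ∑ y ∈ (hfin x).toFinset, B.indicator (1 : X → ℝ≥0∞) y =
        ((hfin x).toFinset.filter (· ∈ B)).card := by
      rw [Finset.card_filter]
      push_cast
      exact Finset.sum_congr rfl fun y _ => by simp [Set.indicator_apply]
    rw [h1, ← iSup_sum_exists_prefix_eq_card hφ]
    refine iSup_congr fun n => Finset.sum_congr rfl fun w _ => ?_
    rw [Set.indicator_apply]
    refine if_congr ?_ rfl rfl
    simp only [Finset.mem_filter, Set.Finite.mem_toFinset, Set.mem_preimage,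
      Set.mem_singleton_iff, Set.mem_image, Set.mem_ofPred_eq]
    exact exists_congr fun y => by tauto
  rw [heq]
  refine AEMeasurable.iSup fun n => Finset.aemeasurable_fun_sum _ fun w _ => ?_
  exact aemeasurable_one.indicator₀ (nullMeasurableSet_image hr (hP n w))

theorem aemeasurable_lintegral_fiberMeasure_indicator [IsFiniteMeasure ρ] (hr : Measurable r)
    (hfin : ∀ x, (r ⁻¹' {x}).Finite) {B : Set X} (hB : MeasurableSet B) :
    AEMeasurable (fun x => ∫⁻ y, B.indicator (1 : X → ℝ≥0∞) y ∂fiberMeasure r x) ρ := by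
  have h1 : ∀ x, (((r ⁻¹' {x}).ncard : ℝ≥0∞)) =
      ∑ y ∈ (hfin x).toFinset, Set.univ.indicator (1 : X → ℝ≥0∞) y := fun x => by
    simp [Set.ncard_eq_toFinset_card _ (hfin x)]
  simp only [lintegral_fiberMeasure hfin, h1]
  exact (aemeasurable_card_fiber hr hfin .univ).inv.mul (aemeasurable_card_fiber hr hfin hB)

/-- The only direct appeal to strong invariance. A.e. measurability of the average is what turns its
Bochner integral into a lower Lebesgue integral. -/
theorem lintegral_lintegral_fiberMeasure_indicator [IsProbabilityMeasure ρ] (hr : Measurable r)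
    (hfin : ∀ x, (r ⁻¹' {x}).Finite) (honto : Function.Surjective r)
    (hρ : IsStronglyInvariant r ρ) {B : Set X} (hB : MeasurableSet B) :
    ∫⁻ x, ∫⁻ y, B.indicator (1 : X → ℝ≥0∞) y ∂fiberMeasure r x ∂ρ = ρ B := by
  have hmem : MemLp (B.indicator fun _ => (1 : ℂ)) ∞ ρ :=
    memLp_indicator_const _ hB _ (Or.inr (measure_ne_top _ _))
  have h := hρ _ hmem
  have hA : ∀ x, fiberAverage r (B.indicator fun _ => (1 : ℂ)) x =
      ((∫⁻ y, B.indicator (1 : X → ℝ≥0∞) y ∂fiberMeasure r x).toReal : ℂ) := by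
    intro x
    rw [fiberAverage_eq_sum hfin, lintegral_fiberMeasure hfin, ENNReal.toReal_mul,
      ENNReal.toReal_inv, ENNReal.toReal_natCast, ENNReal.toReal_sum]
    · push_cast
      rw [Complex.real_smul]
      push_cast
      congr 1
      refine Finset.sum_congr rfl fun y _ => ?_
      by_cases hy : y ∈ B <;> simp [hy]
    · intro y _
      by_cases hy : y ∈ B <;> simp [hy]
  have hle : ∀ x, ∫⁻ y, B.indicator (1 : X → ℝ≥0∞) y ∂fiberMeasure r x ≤ 1 := by
    intro x
    have := isProbabilityMeasure_fiberMeasure hfin honto x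
    rw [lintegral_indicator_one hB]
    exact prob_le_one
  simp only [hA] at h
  rw [integral_complex_ofReal, integral_indicator_const _ hB, integral_toReal
    (aemeasurable_lintegral_fiberMeasure_indicator hr hfin hB)
    (Filter.Eventually.of_forall fun x => (hle x).trans_lt ENNReal.one_lt_top)] at h
  simp only [Complex.real_smul, mul_one, Complex.ofReal_inj] at h
  refine ((ENNReal.toReal_eq_toReal_iff' ?_ (measure_ne_top _ _)).1 h.symm)
  refine ((lintegral_mono hle).trans_lt ?_).ne
  simp

/-- Strong invariance, for non-negative measurable functions. -/
theorem aemeasurable_and_lintegral_lintegral_fiberMeasure [IsProbabilityMeasure ρ]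
    (hr : Measurable r) (hfin : ∀ x, (r ⁻¹' {x}).Finite) (honto : Function.Surjective r)
    (hρ : IsStronglyInvariant r ρ) {g : X → ℝ≥0∞} (hg : Measurable g) :
    AEMeasurable (fun x => ∫⁻ y, g y ∂fiberMeasure r x) ρ ∧
      ∫⁻ x, ∫⁻ y, g y ∂fiberMeasure r x ∂ρ = ∫⁻ x, g x ∂ρ := by
  refine Measurable.ennreal_induction (motive := fun g =>
    AEMeasurable (fun x => ∫⁻ y, g y ∂fiberMeasure r x) ρ ∧
      ∫⁻ x, ∫⁻ y, g y ∂fiberMeasure r x ∂ρ = ∫⁻ x, g x ∂ρ) ?_ ?_ ?_ hg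
  · intro c s hs
    have h1 : ∀ y, s.indicator (fun _ => c) y = c * s.indicator (1 : X → ℝ≥0∞) y := fun y => by
      by_cases hy : y ∈ s <;> simp [hy]
    have hm := aemeasurable_lintegral_fiberMeasure_indicator (ρ := ρ) hr hfin hs
    have hms : Measurable (s.indicator (1 : X → ℝ≥0∞)) := measurable_one.indicator hs
    simp only [h1, lintegral_const_mul c hms]
    refine ⟨hm.const_mul c, ?_⟩
    rw [lintegral_const_mul'' c hm,
      lintegral_lintegral_fiberMeasure_indicator hr hfin honto hρ hs, lintegral_indicator_one hs]
  · intro f g _ hf hg ihf ihg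
    simp only [Pi.add_apply, lintegral_add_left hf]
    refine ⟨ihf.1.add ihg.1, ?_⟩
    rw [lintegral_add_left' ihf.1, ihf.2, ihg.2]
  · intro f hf hmono ih
    have h1 : ∀ ν : Measure X, ∫⁻ y, ⨆ n, f n y ∂ν = ⨆ n, ∫⁻ y, f n y ∂ν := fun ν =>
      lintegral_iSup hf hmono
    simp only [h1]
    refine ⟨AEMeasurable.iSup fun n => (ih n).1, ?_⟩
    rw [lintegral_iSup' (fun n => (ih n).1)
      (Filter.Eventually.of_forall fun x m n hmn => lintegral_mono (hmono hmn))]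
    exact iSup_congr fun n => (ih n).2

/-- Strong invariance passes null sets to fibres. -/
theorem ae_forall_fiber_of_ae [IsProbabilityMeasure ρ]
    (hr : Measurable r) (hfin : ∀ x, (r ⁻¹' {x}).Finite) (honto : Function.Surjective r)
    (hρ : IsStronglyInvariant r ρ) {p : X → Prop} (hp : ∀ᵐ y ∂ρ, p y) :
    ∀ᵐ x ∂ρ, ∀ y, r y = x → p y := by
  obtain ⟨N, hpN, hN, hN0⟩ := exists_measurable_superset_of_null (ae_iff.1 hp)
  have hm := aemeasurable_lintegral_fiberMeasure_indicator (ρ := ρ) hr hfin hN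
  have h0 := lintegral_lintegral_fiberMeasure_indicator hr hfin honto hρ hN
  rw [hN0, lintegral_eq_zero_iff' hm] at h0
  filter_upwards [h0] with x hx y hy
  rw [Pi.zero_apply, lintegral_fiberMeasure hfin, mul_eq_zero, Finset.sum_eq_zero_iff] at hx
  by_contra hpy
  rcases hx with hx | hx
  · simp at hx
  · have := hx y (by simpa using hy)
    simp [Set.indicator_of_mem (hpN hpy)] at this

theorem lintegral_lintegral_fiberMeasure [IsProbabilityMeasure ρ]
    (hr : Measurable r) (hfin : ∀ x, (r ⁻¹' {x}).Finite) (honto : Function.Surjective r)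
    (hρ : IsStronglyInvariant r ρ) {g : X → ℝ≥0∞} (hg : AEMeasurable g ρ) :
    ∫⁻ x, ∫⁻ y, g y ∂fiberMeasure r x ∂ρ = ∫⁻ x, g x ∂ρ := by
  rw [lintegral_congr_ae hg.ae_eq_mk, ← (aemeasurable_and_lintegral_lintegral_fiberMeasure hr hfin
    honto hρ hg.measurable_mk).2]
  refine lintegral_congr_ae ?_
  filter_upwards [ae_forall_fiber_of_ae hr hfin honto hρ hg.ae_eq_mk] with x hx
  exact lintegral_fiberMeasure_congr hfin hx

/-- The fibre average of 1_B ∘ r is 1_B, since fibre measures have mass one. -/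
theorem measurePreserving_of_isStronglyInvariant [IsProbabilityMeasure ρ]
    (hr : Measurable r) (hfin : ∀ x, (r ⁻¹' {x}).Finite) (honto : Function.Surjective r)
    (hρ : IsStronglyInvariant r ρ) : MeasurePreserving r ρ ρ := by
  refine ⟨hr, Measure.ext fun B hB => ?_⟩
  rw [Measure.map_apply hr hB, ← lintegral_indicator_one (hr hB), ← lintegral_indicator_one hB,
    ← lintegral_lintegral_fiberMeasure hr hfin honto hρ
      (measurable_one.indicator (hr hB)).aemeasurable]
  refine lintegral_congr fun x => ?_
  have := isProbabilityMeasure_fiberMeasure hfin honto x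
  have h := lintegral_fiberMeasure_mul_comp hfin 1 (B.indicator (1 : X → ℝ≥0∞)) x
  simp only [Pi.one_apply, one_mul, lintegral_one, measure_univ] at h
  exact h

end Transfer

/-! ### The zero-one law for the tail σ-algebra. -/

section Averaging

theorem measurableSet_tailSigmaAlgebra_limsup {X Y : Type*} [MeasurableSpace X]
    [MeasurableSpace Y] {r : X → X} (hr : Measurable r) {φ : ℕ → X → Y} (hφ : ∀ k, Measurable (φ k)) {U : Set Y}
    (hU : MeasurableSet U) :
    MeasurableSet[tailSigmaAlgebra r] (⋂ N, ⋃ k ≥ N, (φ k ∘ r^[k]) ⁻¹' U) := by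
  rw [MeasurableSpace.measurableSet_iInf]
  intro n
  -- A limsup ignores its first `n` terms, and every later one factors through `r^[n]`.
  have hshift : (⋂ N, ⋃ k ≥ N, (φ k ∘ r^[k]) ⁻¹' U) =
      r^[n] ⁻¹' ⋂ N, ⋃ k ≥ N + n, (φ k ∘ r^[k - n]) ⁻¹' U := by
    ext x
    simp only [Set.mem_iInter, Set.mem_iUnion, Set.mem_preimage, Function.comp_apply, exists_prop]
    have hit : ∀ k ≥ n, r^[k - n] (r^[n] x) = r^[k] x := fun k hk => by
      rw [← Function.iterate_add_apply, Nat.sub_add_cancel hk]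
    constructor
    · intro h N
      obtain ⟨k, hk, hx⟩ := h (N + n)
      exact ⟨k, hk, by rwa [hit k (by omega)]⟩
    · intro h N
      obtain ⟨k, hk, hx⟩ := h N
      exact ⟨k, by omega, by rwa [hit k (by omega)] at hx⟩
  exact ⟨_, .iInter fun N => .iUnion fun k => .iUnion fun _ =>
    ((hφ k).comp (hr.iterate (k - n))) hU, hshift.symm⟩

/-- `f` is only a.e. equal to functions of `r^[k]`, so {f ∈ U} need not be a tail set; the limsup of
the sets {φ k ∘ r^[k] ∈ U} is one, and agrees with it μ-a.e. A measure μ ≪ ρ is allowed because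
quotients f/g are compared only where g ≠ 0. -/
theorem ae_const_of_isAveraging {X Y : Type*} [MeasurableSpace X] [MeasurableSpace Y] [Nonempty Y]
    [HasCountableSeparatingOn Y MeasurableSet Set.univ] {r : X → X} (hr : Measurable r)
    {ρ μ : Measure X} [IsProbabilityMeasure ρ] (hav : IsAveraging r ρ) (hμ : μ ≪ ρ)
    {f : X → Y} {φ : ℕ → X → Y} (hφ : ∀ k, Measurable (φ k)) (h : ∀ k, f =ᵐ[μ] φ k ∘ r^[k]) :
    ∃ c, f =ᵐ[μ] fun _ => c := by
  refine Filter.exists_eventuallyEq_const_of_forall_separating MeasurableSet fun U hU => ?_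
  have hA := measurableSet_tailSigmaAlgebra_limsup hr hφ hU
  have hAm : MeasurableSet (⋂ N, ⋃ k ≥ N, (φ k ∘ r^[k]) ⁻¹' U) :=
    .iInter fun N => .iUnion fun k => .iUnion fun _ => ((hφ k).comp (hr.iterate k)) hU
  have hmem : ∀ᵐ x ∂μ, x ∈ (⋂ N, ⋃ k ≥ N, (φ k ∘ r^[k]) ⁻¹' U) ↔ f x ∈ U := by
    filter_upwards [ae_all_iff.2 h] with x hx
    simp only [Set.mem_iInter, Set.mem_iUnion, Set.mem_preimage, ← hx]
    exact ⟨fun h => (h 0).choose_spec.choose_spec, fun h N => ⟨N, le_rfl, h⟩⟩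
  rcases hav _ hA with h0 | h1
  · right
    have h0' := hμ h0
    filter_upwards [hmem, measure_eq_zero_iff_ae_notMem.1 h0'] with x hx hx'
    rwa [← hx]
  · left
    have h1' : ∀ᵐ x ∂μ, x ∈ (⋂ N, ⋃ k ≥ N, (φ k ∘ r^[k]) ⁻¹' U) :=
      hμ.ae_le ((mem_ae_iff_prob_eq_one hAm).2 h1)
    filter_upwards [hmem, h1'] with x hx hx'
    rwa [← hx]

end Averaging

/-! ### Harmonic and superharmonic functions of the fibre average. -/

section Superharmonic

variable {X : Type*} [MetricSpace X] [CompactSpace X] [MeasurableSpace X] [BorelSpace X]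
  {r : X → X} {ρ : Measure X}

/-- Expand ∫ (w∘r − w)² dρ: the square of w∘r integrates to ∫ w² by invariance, the cross term ∫ w ·
w∘r to ∫ w² by harmonicity, so the total is 0. Boundedness makes all terms integrable. -/
theorem comp_ae_eq_of_lintegral_fiberMeasure_ae_eq [IsProbabilityMeasure ρ]
    (hr : Measurable r) (hfin : ∀ x, (r ⁻¹' {x}).Finite) (honto : Function.Surjective r)
    (hρ : IsStronglyInvariant r ρ) {w : X → ℝ≥0∞} (hw : Measurable w) {c : ℝ≥0∞} (hc : c ≠ ∞)
    (hwc : ∀ x, w x ≤ c) (h : (fun x => ∫⁻ y, w y ∂fiberMeasure r x) =ᵐ[ρ] w) :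
    w ∘ r =ᵐ[ρ] w := by
  have hmp := measurePreserving_of_isStronglyInvariant hr hfin honto hρ
  have hfinw : ∀ x, w x ≠ ∞ := fun x => ne_top_of_le_ne_top hc (hwc x)
  have h1 : ∫⁻ x, w (r x) * w (r x) ∂ρ = ∫⁻ x, w x * w x ∂ρ :=
    hmp.lintegral_comp (hw.mul hw)
  have h2 : ∫⁻ x, w x * w (r x) ∂ρ = ∫⁻ x, w x * w x ∂ρ := by
    have hm : Measurable fun x => w x * w (r x) := hw.mul (hw.comp hr)
    rw [← lintegral_lintegral_fiberMeasure hr hfin honto hρ hm.aemeasurable]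
    refine lintegral_congr_ae ?_
    filter_upwards [h] with x hx
    have := lintegral_fiberMeasure_mul_comp hfin w w x
    rw [hx] at this
    exact this
  let v : X → ℝ := fun x => (w x).toReal
  have hv : Measurable v := hw.ennreal_toReal
  have hint : ∀ a b : X → X, Measurable a → Measurable b →
      Integrable (fun x => v (a x) * v (b x)) ρ := by
    intro a b ha hb
    refine Integrable.of_bound ((hv.comp ha).mul (hv.comp hb)).aestronglyMeasurable
      (c.toReal * c.toReal) (Filter.Eventually.of_forall fun x => ?_)
    rw [norm_mul, Real.norm_of_nonneg ENNReal.toReal_nonneg,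
      Real.norm_of_nonneg ENNReal.toReal_nonneg]
    exact mul_le_mul (ENNReal.toReal_mono hc (hwc _)) (ENNReal.toReal_mono hc (hwc _))
      ENNReal.toReal_nonneg ENNReal.toReal_nonneg
  have hreal : ∀ a b : X → X, Measurable a → Measurable b →
      ∫ x, v (a x) * v (b x) ∂ρ = (∫⁻ x, w (a x) * w (b x) ∂ρ).toReal := by
    intro a b ha hb
    have hm : Measurable fun x => w (a x) * w (b x) := (hw.comp ha).mul (hw.comp hb)
    rw [← integral_toReal hm.aemeasurable
      (Filter.Eventually.of_forall fun x => ENNReal.mul_lt_top (hfinw _).lt_top (hfinw _).lt_top)]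
    exact integral_congr_ae (Filter.Eventually.of_forall fun x => ENNReal.toReal_mul.symm)
  have i1 := hint r r hr hr
  have i2 : Integrable (fun x => 2 * (v x * v (r x))) ρ := (hint id r measurable_id hr).const_mul 2
  have i3 : Integrable (fun x => v x * v x) ρ := hint id id measurable_id measurable_id
  have e2 : ∫ x, v x * v (r x) ∂ρ = (∫⁻ x, w x * w (r x) ∂ρ).toReal :=
    hreal id r measurable_id hr
  have e3 : ∫ x, v x * v x ∂ρ = (∫⁻ x, w x * w x ∂ρ).toReal :=
    hreal id id measurable_id measurable_id
  have i12 : Integrable (fun x => v (r x) * v (r x) - 2 * (v x * v (r x))) ρ := i1.sub i2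
  have h0 : ∫ x, (v (r x) * v (r x) - 2 * (v x * v (r x)) + v x * v x) ∂ρ = 0 := by
    rw [integral_add i12 i3, integral_sub i1 i2, integral_const_mul, hreal r r hr hr, e2, e3,
      h1, h2]
    ring
  have hsq : ∀ x, v (r x) * v (r x) - 2 * (v x * v (r x)) + v x * v x = (v (r x) - v x) ^ 2 :=
    fun x => by ring
  have i123 : Integrable (fun x => v (r x) * v (r x) - 2 * (v x * v (r x)) + v x * v x) ρ :=
    i12.add i3
  rw [integral_eq_zero_iff_of_nonneg (fun x => by
    rw [hsq]; exact sq_nonneg _) i123] at h0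
  filter_upwards [h0] with x hx
  rw [hsq, Pi.zero_apply, sq_eq_zero_iff, sub_eq_zero] at hx
  exact (ENNReal.toReal_eq_toReal_iff' (hfinw _) (hfinw _)).1 hx

/-- If `r` is averaging, superharmonic functions for the fibre average are constant. -/
theorem ae_const_of_lintegral_fiberMeasure_le [IsProbabilityMeasure ρ]
    (hr : Measurable r) (hfin : ∀ x, (r ⁻¹' {x}).Finite) (honto : Function.Surjective r)
    (hρ : IsStronglyInvariant r ρ) (hav : IsAveraging r ρ) {w : X → ℝ≥0∞} (hw : AEMeasurable w ρ)
    (h : (fun x => ∫⁻ y, w y ∂fiberMeasure r x) ≤ᵐ[ρ] w) : ∃ c, w =ᵐ[ρ] fun _ => c := by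
  wlog hwm : Measurable w generalizing w
  · have hmk := hw.ae_eq_mk
    obtain ⟨c, hc⟩ := this hw.measurable_mk.aemeasurable (by
      filter_upwards [h, hmk, ae_forall_fiber_of_ae hr hfin honto hρ hmk] with x h1 h2 h3
      rwa [← h2, ← lintegral_fiberMeasure_congr hfin h3]) hw.measurable_mk
    exact ⟨c, hmk.trans hc⟩
  have hmp := measurePreserving_of_isStronglyInvariant hr hfin honto hρ
  -- Truncation preserves superharmonicity and makes the integral finite. Since averaging preserves
  -- the integral, the inequality is then an a.e. equality.
  have htrunc : ∀ n : ℕ, ∃ c, (fun x => min (w x) n) =ᵐ[ρ] fun _ => c := by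
    intro n
    let u : X → ℝ≥0∞ := fun x => min (w x) n
    have hu : Measurable u := hwm.min measurable_const
    have hle : (fun x => ∫⁻ y, u y ∂fiberMeasure r x) ≤ᵐ[ρ] u := by
      filter_upwards [h] with x hx
      have := isProbabilityMeasure_fiberMeasure hfin honto x
      refine le_min ((lintegral_mono fun y => min_le_left _ _).trans hx) ?_
      refine (lintegral_mono (fun y => min_le_right _ _)).trans ?_
      simp
    have hint := lintegral_lintegral_fiberMeasure hr hfin honto hρ hu.aemeasurable
    have hfinite : ∫⁻ x, u x ∂ρ ≠ ∞ := by
      refine ne_top_of_le_ne_top (ENNReal.natCast_ne_top n)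
        ((lintegral_mono (fun y => min_le_right _ _)).trans ?_)
      simp
    have heq := ae_eq_of_ae_le_of_lintegral_le hle (by rwa [hint]) hu.aemeasurable hint.ge
    have hcomp : u ∘ r =ᵐ[ρ] u := comp_ae_eq_of_lintegral_fiberMeasure_ae_eq hr hfin honto hρ hu
      (ENNReal.natCast_ne_top n) (fun x => min_le_right _ _) heq
    refine ae_const_of_isAveraging hr hav Measure.AbsolutelyContinuous.rfl (φ := fun _ => u)
      (fun _ => hu) fun k => ?_
    induction k with
    | zero => rfl
    | succ k ih =>
      exact hcomp.symm.trans (hmp.quasiMeasurePreserving.ae_eq_comp ih)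
  choose c hc using htrunc
  refine ⟨⨆ n, c n, ?_⟩
  filter_upwards [ae_all_iff.2 hc] with x hx
  simp only [← hx]
  rw [← inf_iSup_eq, ENNReal.iSup_natCast, inf_top_eq]

end Superharmonic

/-! ### The isometry identity for h dρ. -/

section Isometry

variable {X : Type*} [MetricSpace X] [CompactSpace X] [MeasurableSpace X] [BorelSpace X]
  {r : X → X} {ρ : Measure X}

theorem lintegral_mul_comp_withDensity [IsProbabilityMeasure ρ]
    (hr : Measurable r) (hfin : ∀ x, (r ⁻¹' {x}).Finite) (honto : Function.Surjective r)
    (hρ : IsStronglyInvariant r ρ) {M H : X → ℝ≥0∞} (hM : AEMeasurable M ρ)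
    (hH : AEMeasurable H ρ) (hMH : ∀ᵐ x ∂ρ, ∫⁻ y, M y * H y ∂fiberMeasure r x = H x)
    {F : X → ℝ≥0∞} (hF : Measurable F) :
    ∫⁻ x, M x * F (r x) ∂ρ.withDensity H = ∫⁻ x, F x ∂ρ.withDensity H := by
  have hm : AEMeasurable (fun x => M x * F (r x)) ρ := hM.mul (hF.comp hr).aemeasurable
  rw [lintegral_withDensity_eq_lintegral_mul₀ hH hm,
    lintegral_withDensity_eq_lintegral_mul₀ hH hF.aemeasurable,
    ← lintegral_lintegral_fiberMeasure hr hfin honto hρ (hH.mul hm)]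
  refine lintegral_congr_ae ?_
  filter_upwards [hMH] with x hx
  rw [Pi.mul_apply, ← hx, ← lintegral_fiberMeasure_mul_comp hfin]
  refine lintegral_congr fun y => ?_
  simp only [Pi.mul_apply]
  ring

end Isometry

/-! ### Weighted composition operators and the intersection of their ranges. -/

section WeightedComposition

variable {X : Type*} [MeasurableSpace X] {r : X → X} {μ : Measure X}

/-- `r` may pull a μ-null set back to a non-null one, but testing `hK` on its indicator shows that
the weight vanishes a.e. there. This is why S₀ is well defined on classes. -/
theorem ae_eq_zero_or_comp_of_ae {M : X → ℝ≥0∞} (hr : Measurable r) (hM : AEMeasurable M μ)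
    (hK : ∀ F : X → ℝ≥0∞, Measurable F → ∫⁻ x, M x * F (r x) ∂μ = ∫⁻ x, F x ∂μ)
    {p : X → Prop} (hp : ∀ᵐ x ∂μ, p x) : ∀ᵐ x ∂μ, M x = 0 ∨ p (r x) := by
  obtain ⟨N, hpN, hN, hN0⟩ := exists_measurable_superset_of_null (ae_iff.1 hp)
  have hmeas : Measurable (N.indicator (1 : X → ℝ≥0∞)) := measurable_one.indicator hN
  have h0 := hK _ hmeas
  have hm : AEMeasurable (fun x => M x * N.indicator (1 : X → ℝ≥0∞) (r x)) μ :=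
    hM.mul (hmeas.comp hr).aemeasurable
  rw [lintegral_indicator_one hN, hN0, lintegral_eq_zero_iff' hm] at h0
  filter_upwards [h0] with x hx
  rw [Pi.zero_apply, mul_eq_zero] at hx
  refine hx.imp id fun hx' => ?_
  by_contra hpx
  simp [Set.indicator_of_mem (hpN hpx)] at hx'

variable {m : X → ℂ}

theorem mul_comp_ae_eq (hr : Measurable r) (hm : AEStronglyMeasurable m μ)
    (hK : ∀ F : X → ℝ≥0∞, Measurable F → ∫⁻ x, ‖m x‖ₑ ^ 2 * F (r x) ∂μ = ∫⁻ x, F x ∂μ)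
    {f g : X → ℂ} (hfg : f =ᵐ[μ] g) :
    (fun x => m x * f (r x)) =ᵐ[μ] fun x => m x * g (r x) := by
  filter_upwards [ae_eq_zero_or_comp_of_ae hr (hm.enorm.pow_const 2) hK hfg] with x hx
  rcases hx with hx | hx
  · have : m x = 0 := by simpa using hx
    simp [this]
  · rw [hx]

theorem aestronglyMeasurable_mul_comp (hr : Measurable r) (hm : AEStronglyMeasurable m μ)
    (hK : ∀ F : X → ℝ≥0∞, Measurable F → ∫⁻ x, ‖m x‖ₑ ^ 2 * F (r x) ∂μ = ∫⁻ x, F x ∂μ)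
    {f : X → ℂ} (hf : AEStronglyMeasurable f μ) :
    AEStronglyMeasurable (fun x => m x * f (r x)) μ :=
  (hm.mul (hf.stronglyMeasurable_mk.comp_measurable hr).aestronglyMeasurable).congr
    (mul_comp_ae_eq hr hm hK hf.ae_eq_mk).symm

theorem eLpNorm_mul_comp (hr : Measurable r) (hm : AEStronglyMeasurable m μ)
    (hK : ∀ F : X → ℝ≥0∞, Measurable F → ∫⁻ x, ‖m x‖ₑ ^ 2 * F (r x) ∂μ = ∫⁻ x, F x ∂μ)
    {f : X → ℂ} (hf : AEStronglyMeasurable f μ) :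
    eLpNorm (fun x => m x * f (r x)) 2 μ = eLpNorm f 2 μ := by
  rw [eLpNorm_congr_ae (mul_comp_ae_eq hr hm hK hf.ae_eq_mk), eLpNorm_congr_ae hf.ae_eq_mk,
    eLpNorm_eq_lintegral_rpow_enorm_toReal two_ne_zero ENNReal.ofNat_ne_top,
    eLpNorm_eq_lintegral_rpow_enorm_toReal two_ne_zero ENNReal.ofNat_ne_top]
  simp only [ENNReal.toReal_ofNat, ENNReal.rpow_ofNat, enorm_mul, mul_pow]
  rw [hK (fun x => ‖hf.mk f x‖ₑ ^ 2) (hf.stronglyMeasurable_mk.measurable.enorm.pow_const 2)]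

/-- The isometry `f ↦ m · (f ∘ r)` of `L²(μ)`. -/
theorem exists_linearIsometry_mul_comp (hr : Measurable r) (hm : AEStronglyMeasurable m μ)
    (hK : ∀ F : X → ℝ≥0∞, Measurable F → ∫⁻ x, ‖m x‖ₑ ^ 2 * F (r x) ∂μ = ∫⁻ x, F x ∂μ) :
    ∃ S : Lp ℂ 2 μ →ₗᵢ[ℂ] Lp ℂ 2 μ, ∀ F : Lp ℂ 2 μ, S F =ᵐ[μ] fun x => m x * F (r x) := by
  have hmem : ∀ F : Lp ℂ 2 μ, MemLp (fun x => m x * F (r x)) 2 μ := fun F =>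
    ⟨aestronglyMeasurable_mul_comp hr hm hK (Lp.aestronglyMeasurable F), by
      rw [eLpNorm_mul_comp hr hm hK (Lp.aestronglyMeasurable F)]
      exact (Lp.memLp F).eLpNorm_lt_top⟩
  refine ⟨{ toFun := fun F => (hmem F).toLp _, map_add' := ?_, map_smul' := ?_, norm_map' := ?_ },
    fun F => (hmem F).coeFn_toLp⟩
  · intro F G
    rw [← MemLp.toLp_add, MemLp.toLp_eq_toLp_iff]
    filter_upwards [mul_comp_ae_eq hr hm hK (Lp.coeFn_add F G)] with x hx
    rw [hx]
    simp [mul_add]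
  · intro c F
    rw [RingHom.id_apply, ← MemLp.toLp_const_smul, MemLp.toLp_eq_toLp_iff]
    filter_upwards [mul_comp_ae_eq hr hm hK (Lp.coeFn_smul c F)] with x hx
    rw [hx]
    simp [mul_left_comm]
  · intro F
    change ‖(hmem F).toLp _‖ = ‖F‖
    rw [Lp.norm_toLp, eLpNorm_mul_comp hr hm hK (Lp.aestronglyMeasurable F), Lp.norm_def]

theorem iterate_mul_comp_ae_eq (hr : Measurable r) (hm : AEStronglyMeasurable m μ)
    (hK : ∀ F : X → ℝ≥0∞, Measurable F → ∫⁻ x, ‖m x‖ₑ ^ 2 * F (r x) ∂μ = ∫⁻ x, F x ∂μ)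
    {S : Lp ℂ 2 μ → Lp ℂ 2 μ} (hS : ∀ F : Lp ℂ 2 μ, S F =ᵐ[μ] fun x => m x * F (r x))
    (k : ℕ) (F : Lp ℂ 2 μ) :
    S^[k] F =ᵐ[μ] fun x => (∏ j ∈ Finset.range k, m (r^[j] x)) * F (r^[k] x) := by
  induction k with
  | zero => simp
  | succ k ih =>
    rw [Function.iterate_succ_apply']
    refine (hS _).trans ((mul_comp_ae_eq hr hm hK ih).trans (Filter.Eventually.of_forall fun x => ?_))
    simp only [Finset.prod_range_succ', Function.iterate_succ_apply, Function.iterate_zero, id]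
    ring

/-- Two elements of all the ranges `Sᵏ(L²)` are proportional where the second does not vanish. -/
theorem exists_ae_eq_mul_of_mem_range_iterate {ρ : Measure X} [IsProbabilityMeasure ρ]
    (hr : Measurable r) (hav : IsAveraging r ρ) (hμ : μ ≪ ρ) (hm : AEStronglyMeasurable m μ)
    (hK : ∀ F : X → ℝ≥0∞, Measurable F → ∫⁻ x, ‖m x‖ₑ ^ 2 * F (r x) ∂μ = ∫⁻ x, F x ∂μ)
    {S : Lp ℂ 2 μ → Lp ℂ 2 μ} (hS : ∀ F : Lp ℂ 2 μ, S F =ᵐ[μ] fun x => m x * F (r x))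
    {f g : Lp ℂ 2 μ} (hf : ∀ k, f ∈ Set.range S^[k]) (hg : ∀ k, g ∈ Set.range S^[k]) :
    ∃ c : ℂ, ∀ᵐ x ∂μ, g x ≠ 0 → f x = c * g x := by
  choose F hF using hf
  choose G hG using hg
  have hs : MeasurableSet {x | g x ≠ 0} :=
    (Lp.stronglyMeasurable g).measurable (measurableSet_singleton 0).compl
  obtain ⟨c, hc⟩ := ae_const_of_isAveraging (μ := μ.restrict {x | g x ≠ 0}) hr hav
    (Measure.absolutelyContinuous_of_le Measure.restrict_le_self |>.trans hμ)
    (f := fun x => f x / g x) (φ := fun k x => F k x / G k x)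
    (fun k => (Lp.stronglyMeasurable (F k)).measurable.div (Lp.stronglyMeasurable (G k)).measurable)
    (fun k => by
      rw [Filter.EventuallyEq, ae_restrict_iff' hs]
      filter_upwards [iterate_mul_comp_ae_eq hr hm hK hS k (F k),
        iterate_mul_comp_ae_eq hr hm hK hS k (G k)] with x hfx hgx hx
      rw [hF] at hfx
      rw [hG] at hgx
      rw [hgx] at hx
      -- The common product along the orbit cancels, leaving a function of `r^[k] x`.
      rw [hfx, hgx, mul_div_mul_left _ _ (left_ne_zero_of_mul hx)]
      rfl)
  refine ⟨c, ?_⟩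
  rw [Filter.EventuallyEq, ae_restrict_iff' hs] at hc
  filter_upwards [hc] with x hx hgx
  exact (div_eq_iff hgx).1 (hx hgx)

/-- The unitary part of `S` is at most one-dimensional. -/
theorem exists_eq_smul_of_mem_range_iterate {ρ : Measure X} [IsProbabilityMeasure ρ]
    (hr : Measurable r) (hav : IsAveraging r ρ) (hμ : μ ≪ ρ) (hm : AEStronglyMeasurable m μ)
    (hK : ∀ F : X → ℝ≥0∞, Measurable F → ∫⁻ x, ‖m x‖ₑ ^ 2 * F (r x) ∂μ = ∫⁻ x, F x ∂μ)
    {S : Lp ℂ 2 μ →ₗᵢ[ℂ] Lp ℂ 2 μ} (hS : ∀ F : Lp ℂ 2 μ, S F =ᵐ[μ] fun x => m x * F (r x))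
    {f g : Lp ℂ 2 μ} (hf : ∀ k, f ∈ Set.range S^[k]) (hg : ∀ k, g ∈ Set.range S^[k])
    (hg0 : g ≠ 0) : ∃ c : ℂ, f = c • g := by
  obtain ⟨c, hc⟩ := exists_ae_eq_mul_of_mem_range_iterate hr hav hμ hm hK hS hf hg
  -- It remains to treat {g = 0}. The function g + (f − cg) equals `g` where g ≠ 0 and `f` where g =
  -- 0. Comparing `g` with it gives a constant, equal to 1 because g ≠ 0 somewhere; so `f` vanishes
  -- a.e. where `g` does.
  have hlin : ∀ k, g + (f - c • g) ∈ Set.range S^[k] := by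
    intro k
    have hpow : Set.range S^[k] = (LinearMap.range (S.toLinearMap ^ k) : Set (Lp ℂ 2 μ)) := by
      rw [LinearMap.coe_range, Module.End.coe_pow]
      rfl
    have hf' := hf k
    have hg' := hg k
    rw [hpow] at hf' hg' ⊢
    exact add_mem hg' (sub_mem hf' (Submodule.smul_mem _ c hg'))
  obtain ⟨c', hc'⟩ := exists_ae_eq_mul_of_mem_range_iterate hr hav hμ hm hK hS hg hlin
  have hval : ∀ᵐ x ∂μ, (g + (f - c • g) : Lp ℂ 2 μ) x = g x + (f x - c * g x) := by
    filter_upwards [Lp.coeFn_add g (f - c • g), Lp.coeFn_sub f (c • g), Lp.coeFn_smul c g]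
      with x h1 h2 h3
    rw [h1, Pi.add_apply, h2, Pi.sub_apply, h3, Pi.smul_apply, smul_eq_mul]
  have hc1 : c' = 1 := by
    by_contra hne
    refine hg0 (Lp.eq_zero_iff_ae_eq_zero.2 ?_)
    filter_upwards [hc, hc', hval] with x h1 h2 h3
    by_contra hgx
    have hgx : g x ≠ 0 := hgx
    rw [h3, h1 hgx, sub_self, add_zero] at h2
    exact hne (mul_right_cancel₀ hgx ((h2 hgx).symm.trans (one_mul _).symm))
  refine ⟨c, Lp.ext ?_⟩
  filter_upwards [hc, hc', hval, Lp.coeFn_smul c g] with x h1 h2 h3 h4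
  rw [h4, Pi.smul_apply, smul_eq_mul]
  by_cases hgx : g x = 0
  · by_contra hne
    rw [h3, hc1, hgx] at h2
    simp only [mul_zero, sub_zero, zero_add, one_mul] at h2
    rw [hgx, mul_zero] at hne
    exact hne (h2 hne).symm
  · exact h1 hgx

end WeightedComposition

/-! ### Eigenvectors, and the conclusion. -/

theorem lintegral_enorm_sq_ne_zero {X : Type*} [MeasurableSpace X] {μ : Measure X}
    {f : Lp ℂ 2 μ} (hf : f ≠ 0) : ∫⁻ x, ‖f x‖ₑ ^ 2 ∂μ ≠ 0 := by
  rw [Ne, lintegral_eq_zero_iff ((Lp.stronglyMeasurable f).measurable.enorm.pow_const 2)]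
  refine fun h => hf (Lp.eq_zero_iff_ae_eq_zero.2 ?_)
  filter_upwards [h] with x hx
  simpa using hx

/-- If a non-zero `f` satisfies `m · (f ∘ r) = c f` with `|c| = 1`, then `|m| = 1` almost
everywhere. -/
theorem enorm_sq_ae_eq_one_of_eigenvector {X : Type*} [MetricSpace X] [CompactSpace X]
    [MeasurableSpace X] [BorelSpace X] {r : X → X} {ρ : Measure X} [IsProbabilityMeasure ρ]
    (hr : Measurable r) (hfin : ∀ x, (r ⁻¹' {x}).Finite) (honto : Function.Surjective r)
    (hρ : IsStronglyInvariant r ρ) (hav : IsAveraging r ρ) {M H u : X → ℝ≥0∞}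
    (hM : ∀ᵐ x ∂ρ, ∫⁻ y, M y ∂fiberMeasure r x = 1)
    (hH : AEMeasurable H ρ)
    (hMH : ∀ᵐ x ∂ρ, ∫⁻ y, M y * H y ∂fiberMeasure r x = H x)
    (hu : Measurable u) (hutop : ∀ x, u x ≠ ∞) (hu0 : ∫⁻ x, u x ∂ρ.withDensity H ≠ 0)
    (hMu : ∀ᵐ x ∂ρ.withDensity H, M x * u (r x) = u x) : ∀ᵐ x ∂ρ, M x = 1 := by
  rw [ae_withDensity_iff' hH] at hMu
  rw [lintegral_withDensity_eq_lintegral_mul₀ hH hu.aemeasurable] at hu0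
  have hfib := ae_forall_fiber_of_ae hr hfin honto hρ hMu
  -- `H * u` is harmonic: the average of H M · u∘r is H u. The relation for `u` is needed only where
  -- H ≠ 0, which is all that `hMu` provides.
  obtain ⟨c, hc⟩ := ae_const_of_lintegral_fiberMeasure_le hr hfin honto hρ hav
    (hH.mul hu.aemeasurable) (by
      filter_upwards [hMH, hfib] with x h1 h2
      rw [Pi.mul_apply, ← h1, ← lintegral_fiberMeasure_mul_comp hfin]
      refine (lintegral_fiberMeasure_congr hfin fun y hy => ?_).le
      rw [Pi.mul_apply]
      by_cases hy0 : H y = 0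
      · simp [hy0]
      · rw [← h2 y hy hy0]; ring)
  have hc0 : c ≠ 0 := by
    rintro rfl
    exact hu0 (by rw [lintegral_congr_ae hc]; simp)
  have hpos : ∀ᵐ x ∂ρ, H x ≠ 0 ∧ u x ≠ 0 := by
    filter_upwards [hc] with x hx
    exact mul_ne_zero_iff.1 (by rwa [← Pi.mul_apply, hx])
  -- As H > 0 a.e., the relation now holds ρ-a.e., so `u` itself can be averaged without the weight.
  have hMu' : ∀ᵐ x ∂ρ, M x * u (r x) = u x := by
    filter_upwards [hMu, hpos] with x h1 h2 using h1 h2.1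
  obtain ⟨c', hc'⟩ := ae_const_of_lintegral_fiberMeasure_le hr hfin honto hρ hav
    hu.aemeasurable (by
      filter_upwards [hM, ae_forall_fiber_of_ae hr hfin honto hρ hMu'] with x h1 h2
      refine le_of_eq ?_
      rw [← lintegral_fiberMeasure_congr hfin h2, lintegral_fiberMeasure_mul_comp hfin, h1,
        one_mul])
  have hqmp := (measurePreserving_of_isStronglyInvariant hr hfin honto hρ).quasiMeasurePreserving
  filter_upwards [hMu', hc', hqmp.ae hc', hpos] with x h1 h2 h3 h4
  rw [h3, ← h2] at h1
  exact (ENNReal.mul_eq_right h4.2 (hutop x)).1 h1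

theorem mainTheorem2 {X : Type*} [MetricSpace X] [CompactSpace X] [MeasurableSpace X]
    [BorelSpace X] (r : X → X) (hr_meas : Measurable r) (hr_onto : Function.Surjective r)
    (hr_fin : ∀ x, (r ⁻¹' {x}).Finite)
    (ρ : Measure X) [IsProbabilityMeasure ρ] (hρ : IsStronglyInvariant r ρ)
    (m₀ : X → ℂ) (hm₀ : MemLp m₀ ∞ ρ)
    (hm₀_quad : ∀ᵐ x ∂ρ, fiberAverage r (fun y => ‖m₀ y‖ ^ 2) x = 1)
    (h : X → ℝ) (hh : MemLp h ∞ ρ) (hh_nonneg : ∀ᵐ x ∂ρ, 0 ≤ h x)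
    (hh_harm : ∀ᵐ x ∂ρ, fiberAverage r (fun y => ‖m₀ y‖ ^ 2 * h y) x = h x) :
    ∃ S₀ : Lp ℂ 2 (weightedMeasure ρ h) →ₗᵢ[ℂ] Lp ℂ 2 (weightedMeasure ρ h),
      (∀ (f : X → ℂ) (hf : MemLp f 2 (weightedMeasure ρ h)),
        ∀ᵐ x ∂(weightedMeasure ρ h), S₀ (hf.toLp f) x = m₀ x * f (r x)) ∧
      (IsAveraging r ρ → 0 < ρ {x | ‖m₀ x‖ ≠ 1} →
        ⋂ k ∈ Set.Ici (1 : ℕ), Set.range (S₀^[k]) = {0}) := by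
  have henorm : ∀ y, ‖m₀ y‖ₑ ^ 2 = ENNReal.ofReal (‖m₀ y‖ ^ 2) := fun y => by
    rw [ENNReal.ofReal_pow (norm_nonneg _), ofReal_norm]
  have hH : AEMeasurable (fun x => ENNReal.ofReal (h x)) ρ :=
    hh.aestronglyMeasurable.aemeasurable.ennreal_ofReal
  have hM : ∀ᵐ x ∂ρ, ∫⁻ y, ‖m₀ y‖ₑ ^ 2 ∂fiberMeasure r x = 1 := by
    filter_upwards [hm₀_quad] with x hx
    rw [← ENNReal.ofReal_one, ← hx, ofReal_fiberAverage hr_fin hr_onto fun y _ => sq_nonneg _]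
    simp only [henorm]
  have hMH : ∀ᵐ x ∂ρ, ∫⁻ y, ‖m₀ y‖ₑ ^ 2 * ENNReal.ofReal (h y) ∂fiberMeasure r x =
      ENNReal.ofReal (h x) := by
    filter_upwards [hh_harm, ae_forall_fiber_of_ae hr_meas hr_fin hr_onto hρ hh_nonneg]
      with x hx hpos
    rw [← hx, ofReal_fiberAverage hr_fin hr_onto fun y hy => mul_nonneg (sq_nonneg _) (hpos y hy)]
    simp only [henorm, ENNReal.ofReal_mul (sq_nonneg _)]
  have hac : weightedMeasure ρ h ≪ ρ := withDensity_absolutelyContinuous _ _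
  have hm : AEStronglyMeasurable m₀ (weightedMeasure ρ h) := hm₀.aestronglyMeasurable.mono_ac hac
  have hK : ∀ F : X → ℝ≥0∞, Measurable F →
      ∫⁻ x, ‖m₀ x‖ₑ ^ 2 * F (r x) ∂weightedMeasure ρ h = ∫⁻ x, F x ∂weightedMeasure ρ h :=
    fun F hF => lintegral_mul_comp_withDensity hr_meas hr_fin hr_onto hρ
      (hm₀.aestronglyMeasurable.enorm.pow_const 2) hH hMH hF
  obtain ⟨S, hS⟩ := exists_linearIsometry_mul_comp hr_meas hm hK
  refine ⟨S, fun f hf => (hS _).trans (mul_comp_ae_eq hr_meas hm hK hf.coeFn_toLp), ?_⟩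
  intro hav hpos
  refine Set.eq_singleton_iff_unique_mem.2 ⟨?_, fun f hf => ?_⟩
  · exact Set.mem_iInter₂.2 fun k _ => ⟨0, Function.iterate_fixed (map_zero S) k⟩
  by_contra hf0
  have hf' : ∀ k, f ∈ Set.range S^[k] := by
    intro k
    rcases Nat.eq_zero_or_pos k with rfl | hk
    · exact ⟨f, rfl⟩
    · exact Set.mem_iInter₂.1 hf k hk
  -- The intersection is `S`-invariant and at most one-dimensional, so `f` is an eigenvector.
  have hSf : ∀ k, S f ∈ Set.range S^[k] := fun k => by
    obtain ⟨F, hF⟩ := hf' k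
    exact ⟨S F, by rw [← hF, ← Function.iterate_succ_apply, Function.iterate_succ_apply']⟩
  obtain ⟨c, hc⟩ := exists_eq_smul_of_mem_range_iterate hr_meas hav hac hm hK hS hSf hf' hf0
  have hc1 : ‖c‖ₑ = 1 := by
    have hn : ‖c‖ * ‖f‖ = 1 * ‖f‖ := by rw [← norm_smul, ← hc, S.norm_map, one_mul]
    rw [← ofReal_norm, mul_right_cancel₀ (norm_ne_zero_iff.2 hf0) hn, ENNReal.ofReal_one]
  have hone := enorm_sq_ae_eq_one_of_eigenvector hr_meas hr_fin hr_onto hρ hav hM hH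
    hMH (u := fun x => ‖f x‖ₑ ^ 2)
    ((Lp.stronglyMeasurable f).measurable.enorm.pow_const 2)
    (fun x => ENNReal.pow_ne_top enorm_ne_top) (lintegral_enorm_sq_ne_zero hf0) (by
      have hfc := Lp.coeFn_smul c f
      rw [← hc] at hfc
      filter_upwards [hS f, hfc] with x h1 h2
      rw [← mul_pow, ← enorm_mul, ← h1, h2, Pi.smul_apply, smul_eq_mul, enorm_mul, hc1, one_mul])
  suffices hae : ∀ᵐ x ∂ρ, ‖m₀ x‖ = 1 from hpos.ne' (ae_iff.1 hae)
  filter_upwards [hone] with x hx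
  rw [henorm, ENNReal.ofReal_eq_one] at hx
  exact (pow_eq_one_iff_of_nonneg (norm_nonneg _) two_ne_zero).1 hx
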